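/- Let $(Z_{\mathbf t})_{\mathbf t\in\mathbb Z^2}$ be an i.i.d. complex-valued random field on a probability space $(\Omega,\mathcal F,\mathbb P)$ which is nondeterministic, i.e. $Z_{\mathbf 0}$ is not almost surely constant. Let $R,S$ be finite subsets of $\mathbb N_0^2\setminus\{\mathbf 0\}$, let $(\phi_{\mathbf n})_{\mathbf n\in R}$ and $(\theta_{\mathbf n})_{\mathbf n\in S}$ be complex coefficients, and put $$\Phi(z_1,z_2)=1-\sum_{\mathbf n\in R}\phi_{\mathbf n}z_1^{n_1}z_2^{n_2},\qquad \Theta(z_1,z_2)=1+\sum_{\mathbf n\in S}\theta_{\mathbf n}z_1^{n_1}z_2^{n_2}.$$ Suppose that $\Theta\equiv1$ (a pure autoregressive model). A causal solution of the model is a strictly stationary complex-valued random field $(Y_{\mathbf t})_{\mathbf t\in\mathbb Z^2}$ on $(\Omega,\mathcal F,\mathbb P)$ such that $$Y_{\mathbf t}-\sum_{\mathbf n\in R}\phi_{\mathbf n}Y_{\mathbf t-\mathbf n}=Z_{\mathbf t}+\sum_{\mathbf n\in S}\theta_{\mathbf n}Z_{\mathbf t-\mathbf n}\quad\text{almost surely,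 for every }\mathbf t\in\mathbb Z^2,$$ and such that, for every $\mathbf t\in\mathbb Z^2$, $Y_{\mathbf t}$ is measurable with respect to $\sigma(Z_{\mathbf s}:\mathbf s\in\mathbb Z^2,\ s_1\le t_1,\ s_2\le t_2)$. If a causal solution exists, then $$\Phi(z_1,z_2)\neq0\quad\text{for all }(z_1,z_2)\in\mathbb C^2\text{ with }|z_1|\le1\text{ and }|z_2|\le1.$$ -/

import Mathlib

open MeasureTheory ProbabilityTheory

namespace SpatialARMA

/-- The embedding of `ℕ₀^d` into `ℤ^d`, used for the lags of the model. -/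
def lag {d : ℕ} (n : Fin d → ℕ) : Fin d → ℤ := fun i => (n i : ℤ)

/-- The autoregressive polynomial `Φ(z) = 1 - ∑_{n ∈ R} φ_n z^n`, as a function on `ℂ^d`. -/
noncomputable def arPoly {d : ℕ} (R : Finset (Fin d → ℕ)) (φ : (Fin d → ℕ) → ℂ)
    (z : Fin d → ℂ) : ℂ :=
  1 - ∑ n ∈ R, φ n * ∏ i, z i ^ n i

/-- The moving average polynomial `Θ(z) = 1 + ∑_{n ∈ S} θ_n z^n`, as a function on `ℂ^d`. -/
noncomputable def maPoly {d : ℕ} (S : Finset (Fin d → ℕ)) (θ : (Fin d → ℕ) → ℂ)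
    (z : Fin d → ℂ) : ℂ :=
  1 + ∑ n ∈ S, θ n * ∏ i, z i ^ n i

variable {Ω : Type*} [MeasurableSpace Ω]

/-- An i.i.d. complex-valued random field indexed by `ℤ^d`. -/
structure IsIIDField {d : ℕ} (μ : Measure Ω) (Z : (Fin d → ℤ) → Ω → ℂ) : Prop where
  measurable : ∀ t, Measurable (Z t)
  indep : iIndepFun Z μ
  identDistrib : ∀ s t, IdentDistrib (Z s) (Z t) μ μ

/-- The field is nondeterministic: no `Z_t` is almost surely constant. -/
def IsNondeterministic {d : ℕ} (μ : Measure Ω) (Z : (Fin d → ℤ) → Ω → ℂ) : Prop :=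
  ∀ t, ¬ ∃ c : ℂ, ∀ᵐ ω ∂μ, Z t ω = c

/-- Strict stationarity: the law of the whole field (equivalently, all finite-dimensional
distributions) is invariant under every shift of the index set `ℤ^d`. -/
def IsStrictlyStationary {d : ℕ} (μ : Measure Ω) (Y : (Fin d → ℤ) → Ω → ℂ) : Prop :=
  ∀ h : Fin d → ℤ, IdentDistrib (fun ω t => Y (t + h) ω) (fun ω t => Y t ω) μ μ

/-- The ARMA equation `Y_t - ∑_{n ∈ R} φ_n Y_{t-n} = Z_t + ∑_{n ∈ S} θ_n Z_{t-n}`, almost surely,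
for every `t ∈ ℤ^d`. -/
def SolvesARMA {d : ℕ} (μ : Measure Ω) (R S : Finset (Fin d → ℕ)) (φ θ : (Fin d → ℕ) → ℂ)
    (Z Y : (Fin d → ℤ) → Ω → ℂ) : Prop :=
  ∀ t, ∀ᵐ ω ∂μ, Y t ω - ∑ n ∈ R, φ n * Y (t - lag n) ω
    = Z t ω + ∑ n ∈ S, θ n * Z (t - lag n) ω

/-- The σ-algebra `σ(Z_s : s ≤ t)`, with `≤` the coordinatewise order on `ℤ^d`. -/
noncomputable abbrev pastSigma {d : ℕ} (Z : (Fin d → ℤ) → Ω → ℂ) (t : Fin d → ℤ) : MeasurableSpace Ω :=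
  ⨆ s : Fin d → ℤ, ⨆ _ : s ≤ t, MeasurableSpace.comap (Z s) inferInstance

/-- A causal solution of the ARMA equation: a strictly stationary solution `Y` such that each
`Y_t` is measurable with respect to `σ(Z_s : s ≤ t)`. -/
structure IsCausalSolution {d : ℕ} (μ : Measure Ω) (R S : Finset (Fin d → ℕ))
    (φ θ : (Fin d → ℕ) → ℂ) (Z Y : (Fin d → ℤ) → Ω → ℂ) : Prop where
  stationary : IsStrictlyStationary μ Y
  solves : SolvesARMA μ R S φ θ Z Y
  causal : ∀ t, Measurable[pastSigma Z t] (Y t)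

end SpatialARMA

/-! Write `Φ = 1 - A`. Iterating the equation `N` times expresses `Y_0` as `∑_{j<N} A^j` in the
backward shifts applied to `Z`, plus `A^N` applied to `Y`. The coefficients of degree below `N` are
those of `1/Φ`. Causality makes everything else independent of their terms, so `|χ_Y|` is at most a
product of factors `|χ_Z|` (`norm_charFun_le_prod_of_causal`). As `χ_Y` is continuous with value 1
at 0 and `Z` is nondegenerate, the coefficients of `1/Φ` are square summable, without any moment
assumption (`exists_sum_sq_le_of_norm_charFun_le`).

Suppose `Φ(z) = 0` in the closed bidisc and let `c_k` be the coefficients of `1/Φ(λz)` in `λ`.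
Degree `k` has only `k + 1` monomials, so Cauchy–Schwarz bounds `∑ |c_k|²/(k+1)`. But `Φ(λz) =
(λ-1)q(λ)`, so `q` times this series is `1/(λ-1)`, whose coefficients are all `-1`. This would bound
the harmonic series (`one_sub_eval_ne_zero_of_sum_sq_le`). -/

namespace SpatialARMA

/-! ### Power series of `1/Φ` along a line through a zero -/

open Finset in
/-- If the product series of `c` with an absolutely summable `q` has coefficients of modulus at
least one, then the weighted square sums of `c` dominate the harmonic sums. -/
theorem harmonic_le_of_one_le_norm_conv (q c : ℕ → ℂ) (N : ℕ) {B : ℝ}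
    (hB : ∑ j ∈ range N, ‖q j‖ ≤ B)
    (h : ∀ k < N, 1 ≤ ‖∑ j ∈ range (k + 1), q j * c (k - j)‖) :
    ∑ k ∈ range N, 1 / ((k : ℝ) + 1) ≤ B ^ 2 * ∑ i ∈ range N, ‖c i‖ ^ 2 / ((i : ℝ) + 1) := by
  have hB0 : 0 ≤ B := (sum_nonneg fun _ _ => norm_nonneg _).trans hB
  have key : ∀ k ∈ range N, 1 / ((k : ℝ) + 1) ≤
      B * ∑ j ∈ range (k + 1), ‖q j‖ * (‖c (k - j)‖ ^ 2 / (((k - j : ℕ) : ℝ) + 1)) := by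
    intro k hk
    have hk' := mem_range.1 hk
    have h1 : 1 ≤ ∑ j ∈ range (k + 1), ‖q j‖ * ‖c (k - j)‖ :=
      (h k hk').trans ((norm_sum_le _ _).trans_eq (by simp))
    -- Cauchy–Schwarz with weights `‖q j‖`.
    have h2 : (∑ j ∈ range (k + 1), ‖q j‖ * ‖c (k - j)‖) ^ 2 ≤
        (∑ j ∈ range (k + 1), ‖q j‖) * ∑ j ∈ range (k + 1), ‖q j‖ * ‖c (k - j)‖ ^ 2 :=
      sum_sq_le_sum_mul_sum_of_sq_le_mul _ (fun _ _ => norm_nonneg _)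
        (fun _ _ => by positivity) (fun _ _ => by rw [mul_pow, pow_two ‖q _‖, mul_assoc])
    have h3 : ∑ j ∈ range (k + 1), ‖q j‖ ≤ B :=
      (sum_le_sum_of_subset_of_nonneg (range_subset_range.2 hk')
        fun _ _ _ => norm_nonneg _).trans hB
    have h4 : 1 ≤ B * ∑ j ∈ range (k + 1), ‖q j‖ * ‖c (k - j)‖ ^ 2 :=
      (one_le_pow₀ h1).trans (h2.trans (mul_le_mul_of_nonneg_right h3
        (sum_nonneg fun _ _ => by positivity)))
    calc 1 / ((k : ℝ) + 1)
        ≤ (B * ∑ j ∈ range (k + 1), ‖q j‖ * ‖c (k - j)‖ ^ 2) / ((k : ℝ) + 1) := by gcongr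
      _ = B * ∑ j ∈ range (k + 1), ‖q j‖ * (‖c (k - j)‖ ^ 2 / ((k : ℝ) + 1)) := by
          rw [mul_div_assoc, sum_div]; simp only [mul_div_assoc]
      _ ≤ _ := by
          gcongr
          omega
  have swap : ∀ F : ℕ → ℕ → ℝ, ∑ k ∈ range N, ∑ j ∈ range (k + 1), F k j
      = ∑ j ∈ range N, ∑ k ∈ Ico j N, F k j := fun F =>
    sum_comm' (by intro x y; simp only [mem_range, mem_Ico]; omega)
  refine (sum_le_sum key).trans ?_
  rw [← mul_sum, swap, pow_two, mul_assoc]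
  refine mul_le_mul_of_nonneg_left ?_ hB0
  set E := ∑ i ∈ range N, ‖c i‖ ^ 2 / ((i : ℝ) + 1)
  have hE : 0 ≤ E := sum_nonneg fun _ _ => by positivity
  refine (sum_le_sum (g := fun j => ‖q j‖ * E) fun j _ => ?_).trans ?_
  · rw [← mul_sum]
    refine mul_le_mul_of_nonneg_left ?_ (norm_nonneg _)
    rw [sum_Ico_eq_sum_range]
    simp only [Nat.add_sub_cancel_left]
    exact sum_le_sum_of_subset_of_nonneg (range_subset_range.2 (Nat.sub_le _ _))
      fun _ _ _ => by positivity
  · rw [← sum_mul]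
    exact mul_le_mul_of_nonneg_right hB hE

open Polynomial in
/-- If `f * (X - 1) = 1 + O(X ^ N)`, then the first `N` coefficients of `f` are `-1`. -/
theorem coeff_eq_neg_one_of_mul_X_sub_one {f r : ℂ[X]} {N : ℕ}
    (h : f * (X - 1) = 1 - X ^ N * r) {k : ℕ} (hk : k < N) : f.coeff k = -1 := by
  induction k with
  | zero =>
    have := congrArg (fun g => coeff g 0) h
    simp [mul_sub, hk.ne] at this
    linear_combination -this
  | succ k ih =>
    have := congrArg (fun g => coeff g (k + 1)) h
    simp [mul_sub, coeff_X_pow_mul', coeff_one, not_le.2 hk] at this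
    rw [← ih (by omega)]
    linear_combination -this

open MvPolynomial in
/-- The coefficient of order `k` of `T` along the line through `z`. -/
theorem coeff_aeval_line {d : ℕ} (T : MvPolynomial (Fin d) ℂ) (z : Fin d → ℂ) (k : ℕ) :
    (aeval (fun i => Polynomial.C (z i) * Polynomial.X) T : Polynomial ℂ).coeff k
      = ∑ n ∈ T.support with n.degree = k, T.coeff n * ∏ i, z i ^ n i := by
  rw [aeval_eq_eval₂Hom, coe_eval₂Hom, eval₂_eq', Polynomial.finsetSum_coeff, Finset.sum_filter]
  refine Finset.sum_congr rfl fun n _ => ?_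
  have : (∏ i, (Polynomial.C (z i) * Polynomial.X) ^ n i : Polynomial ℂ)
      = Polynomial.C (∏ i, z i ^ n i) * Polynomial.X ^ n.degree := by
    simp [mul_pow, Finset.prod_mul_distrib, Finset.prod_pow_eq_pow_sum, Finsupp.degree_eq_sum]
  rw [this, ← mul_assoc, Polynomial.algebraMap_eq, ← Polynomial.C_mul, Polynomial.coeff_C_mul_X_pow]
  simp [eq_comm]

open MvPolynomial in
/-- On the closed bidisc, the weighted square sums of the homogeneous parts of `T` are bounded by
the square sums of the coefficients. -/
theorem sum_sq_coeff_line_le (T : MvPolynomial (Fin 2) ℂ) (z : Fin 2 → ℂ) (hz : ∀ i, ‖z i‖ ≤ 1)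
    (N : ℕ) :
    ∑ k ∈ Finset.range N,
      ‖(aeval (fun i => Polynomial.C (z i) * Polynomial.X) T : Polynomial ℂ).coeff k‖ ^ 2
        / ((k : ℝ) + 1) ≤ ∑ n ∈ T.support with n.degree < N, ‖T.coeff n‖ ^ 2 := by
  have key : ∀ k, ‖(aeval (fun i => Polynomial.C (z i) * Polynomial.X) T : Polynomial ℂ).coeff k‖ ^ 2
        / ((k : ℝ) + 1) ≤ ∑ n ∈ T.support with n.degree = k, ‖T.coeff n‖ ^ 2 := by
    intro k
    rw [coeff_aeval_line, div_le_iff₀ (by positivity)]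
    set s := T.support.filter fun n => n.degree = k
    -- Dimension two enters here: degree and first exponent determine the monomial.
    have hcard : s.card ≤ k + 1 := by
      rw [← Finset.card_range (k + 1)]
      refine Finset.card_le_card_of_injOn (fun n => n 0) ?_ ?_
      · intro n hn
        have hn : n.degree = k := (Finset.mem_filter.1 hn).2
        simp only [Finsupp.degree_eq_sum, Fin.sum_univ_two] at hn
        simp; omega
      · intro n hn m hm hnm
        have hn : n.degree = k := (Finset.mem_filter.1 hn).2
        have hm : m.degree = k := (Finset.mem_filter.1 hm).2
        simp only [Finsupp.degree_eq_sum, Fin.sum_univ_two] at hn hm hnm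
        ext i
        fin_cases i
        · exact hnm
        · simp; omega
    have h1 : ‖∑ n ∈ s, T.coeff n * ∏ i, z i ^ n i‖ ≤ ∑ n ∈ s, ‖T.coeff n‖ := by
      refine (norm_sum_le _ _).trans (Finset.sum_le_sum fun n _ => ?_)
      rw [norm_mul, norm_prod]
      refine mul_le_of_le_one_right (norm_nonneg _)
        (Finset.prod_le_one (fun _ _ => norm_nonneg _) fun i _ => ?_)
      rw [norm_pow]
      exact pow_le_one₀ (norm_nonneg _) (hz i)
    calc _ ≤ (∑ n ∈ s, ‖T.coeff n‖) ^ 2 := by gcongr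
      _ ≤ s.card * ∑ n ∈ s, ‖T.coeff n‖ ^ 2 := sq_sum_le_card_mul_sum_sq
      _ ≤ (k + 1) * ∑ n ∈ s, ‖T.coeff n‖ ^ 2 := by gcongr; exact_mod_cast hcard
      _ = _ := mul_comm _ _
  refine (Finset.sum_le_sum fun k _ => key k).trans_eq ?_
  rw [← Finset.sum_fiberwise_of_maps_to (s := T.support.filter fun n => n.degree < N)
    (t := Finset.range N) (g := fun n => n.degree)
    (fun n hn => Finset.mem_range.2 (Finset.mem_filter.1 hn).2)]
  refine Finset.sum_congr rfl fun k hk => Finset.sum_congr ?_ fun _ _ => rfl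
  ext n
  have := Finset.mem_range.1 hk
  simp only [Finset.mem_filter]
  constructor
  · rintro ⟨h1, rfl⟩; exact ⟨⟨h1, this⟩, rfl⟩
  · rintro ⟨⟨h1, _⟩, h2⟩; exact ⟨h1, h2⟩

open MvPolynomial in
/-- If the low order coefficients of the Neumann sums of `A` are uniformly square summable, then
`1 - A` has no zero on the closed bidisc. -/
theorem one_sub_eval_ne_zero_of_sum_sq_le (A : MvPolynomial (Fin 2) ℂ) (hA : A.coeff 0 = 0) {M : ℝ}
    (hM : ∀ N, ∑ n ∈ (∑ j ∈ Finset.range N, A ^ j).support with n.degree < N,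
      ‖(∑ j ∈ Finset.range N, A ^ j).coeff n‖ ^ 2 ≤ M)
    (z : Fin 2 → ℂ) (hz : ∀ i, ‖z i‖ ≤ 1) : 1 - eval z A ≠ 0 := by
  intro h0
  set L : MvPolynomial (Fin 2) ℂ →ₐ[ℂ] Polynomial ℂ :=
    aeval fun i => Polynomial.C (z i) * Polynomial.X with hL
  have hroot : (1 - L A).IsRoot 1 := by
    have : (Polynomial.aeval (1 : ℂ)).comp L = aeval z := by
      ext i; simp [hL]
    have := DFunLike.congr_fun this A
    rw [AlgHom.comp_apply, Polynomial.coe_aeval_eq_eval] at this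
    rw [Polynomial.IsRoot, Polynomial.eval_sub, this, Polynomial.eval_one, ← h0, aeval_eq_eval]
  obtain ⟨q, hq⟩ := Polynomial.dvd_iff_isRoot.2 hroot
  -- Hence `(L A) ^ N` is divisible by `X ^ N` and does not affect coefficients below `N`.
  obtain ⟨r, hr⟩ : Polynomial.X ∣ L A := by
    rw [Polynomial.X_dvd_iff, hL, coeff_aeval_line]
    refine Finset.sum_eq_zero fun n hn => ?_
    rw [(Finsupp.degree_eq_zero_iff n).1 (Finset.mem_filter.1 hn).2, hA, zero_mul]
  set B := ∑ j ∈ q.support, ‖q.coeff j‖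
  have hB : ∀ N, ∑ j ∈ Finset.range N, ‖q.coeff j‖ ≤ B := by
    intro N
    rw [← Finset.sum_filter_ne_zero]
    refine Finset.sum_le_sum_of_subset_of_nonneg (fun j hj => ?_) fun _ _ _ => norm_nonneg _
    simpa using (Finset.mem_filter.1 hj).2
  have bound : ∀ N, ∑ k ∈ Finset.range N, 1 / ((k : ℝ) + 1) ≤ B ^ 2 * M := by
    intro N
    set T := ∑ j ∈ Finset.range N, A ^ j with hT
    have h1 : (q * L T) * (Polynomial.X - 1) = 1 - Polynomial.X ^ N * r ^ N := by
      have h2 : T * (1 - A) = 1 - A ^ N := geom_sum_mul_neg A N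
      have h3 := congrArg L h2
      rw [map_mul, map_sub, map_sub, map_one, hq, map_pow, hr, mul_pow, Polynomial.C_1] at h3
      rw [← h3]; ring
    refine (harmonic_le_of_one_le_norm_conv q.coeff (L T).coeff N (hB N) fun k hk => ?_).trans ?_
    · have := coeff_eq_neg_one_of_mul_X_sub_one h1 hk
      rw [Polynomial.coeff_mul, Finset.Nat.sum_antidiagonal_eq_sum_range_succ
        (fun i j => q.coeff i * (L T).coeff j)] at this
      rw [this]; simp
    · exact mul_le_mul_of_nonneg_left ((sum_sq_coeff_line_le T z hz N).trans (hM N)) (sq_nonneg _)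
  obtain ⟨N, hN⟩ := (Real.tendsto_sum_range_one_div_nat_succ_atTop.eventually_gt_atTop
    (B ^ 2 * M)).exists
  exact (bound N).not_gt hN

/-! ### Characteristic functions and square summability -/

section

open Complex ComplexConjugate

theorem charFun_map_const_mul {Ω : Type*} [MeasurableSpace Ω] {μ : Measure Ω} {X : Ω → ℂ}
    (hX : Measurable X) (w u : ℂ) :
    charFun (μ.map fun ω => w * X ω) u = charFun (μ.map X) (conj w * u) := by
  rw [charFun_apply, charFun_apply, integral_map (by fun_prop) (by fun_prop),
    integral_map (by fun_prop) (by fun_prop)]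
  refine integral_congr_ae (.of_forall fun ω => ?_)
  simp only [Complex.inner, map_mul]
  congr 4
  ring

/-- `|χ|²` is the characteristic function of the symmetrised variable `x - x'`, hence real. -/
theorem sq_norm_charFun_eq_integral_cos (ν : Measure ℂ) [IsProbabilityMeasure ν] (v : ℂ) :
    ‖charFun ν v‖ ^ 2 = ∫ p, Real.cos (inner ℝ (p.1 - p.2) v) ∂ν.prod ν := by
  have hint : Integrable (fun p : ℂ × ℂ => cexp (inner ℝ p.1 v * I) * cexp (inner ℝ p.2 (-v) * I))
      (ν.prod ν) := by
    refine Integrable.of_bound (by fun_prop) 1 (.of_forall fun p => ?_)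
    rw [norm_mul, norm_exp_ofReal_mul_I, norm_exp_ofReal_mul_I, one_mul]
  have h1 : ((‖charFun ν v‖ ^ 2 : ℝ) : ℂ)
      = ∫ p, cexp (inner ℝ p.1 v * I) * cexp (inner ℝ p.2 (-v) * I) ∂ν.prod ν := by
    rw [integral_prod_mul (fun x : ℂ => cexp (inner ℝ x v * I))
      (fun x : ℂ => cexp (inner ℝ x (-v) * I)), ← charFun_apply, ← charFun_apply, charFun_neg,
      mul_conj, normSq_eq_norm_sq]
  have h2 := congrArg re h1
  rw [ofReal_re] at h2
  rw [h2, ← RCLike.re_eq_complex_re, ← integral_re hint]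
  refine integral_congr_ae (.of_forall fun p => ?_)
  simp only [RCLike.re_eq_complex_re]
  rw [← Complex.exp_add, ← add_mul, ← ofReal_add, exp_ofReal_mul_I_re, inner_sub_left,
    inner_neg_right, sub_eq_add_neg]

/-- The characteristic function of a nondegenerate law decays quadratically near the origin, in at
least one of any two orthogonal directions. -/
theorem exists_quadratic_bound_charFun (ν : Measure ℂ) [IsProbabilityMeasure ν]
    (hν : ¬ ∃ c : ℂ, ∀ᵐ x ∂ν, x = c) :
    ∃ c > 0, ∃ δ > 0, ∀ v : ℂ, ‖v‖ ≤ δ →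
      c * ‖v‖ ^ 2 ≤ (1 - ‖charFun ν v‖ ^ 2) + (1 - ‖charFun ν (v * I)‖ ^ 2) := by
  set ρ := ν.prod ν
  set S : ℕ → Set (ℂ × ℂ) := fun K => {p | ‖p.1 - p.2‖ ≤ K}
  have hS : ∀ K, MeasurableSet (S K) := fun K =>
    measurableSet_le (by fun_prop) measurable_const
  -- Truncating at `K` replaces a second moment, which need not exist. If `x = x'` almost surely,
  -- Fubini makes the law a point mass.
  obtain ⟨K, hK⟩ : ∃ K, ρ ({p | p.1 ≠ p.2} ∩ S K) ≠ 0 := by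
    by_contra! hcon
    have h1 : ρ {p | p.1 ≠ p.2} = 0 := by
      refine measure_mono_null (fun p hp => ?_) (measure_iUnion_null hcon)
      obtain ⟨K, hK⟩ := exists_nat_ge ‖p.1 - p.2‖
      exact Set.mem_iUnion.2 ⟨K, hp, hK⟩
    have h2 : ∀ᵐ p ∂ρ, p.1 = p.2 := h1
    obtain ⟨x, hx⟩ := (Measure.ae_ae_of_ae_prod h2).exists
    exact hν ⟨x, hx.mono fun _ h => h.symm⟩
  set g : ℂ × ℂ → ℝ := (S K).indicator fun p => ‖p.1 - p.2‖ ^ 2 with hg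
  have hg0 : 0 ≤ g := Set.indicator_nonneg fun _ _ => sq_nonneg _
  have hgi : Integrable g ρ := by
    refine Integrable.of_bound
      ((Measurable.indicator (by fun_prop) (hS K)).aestronglyMeasurable) ((K : ℝ) ^ 2)
      (.of_forall fun p => ?_)
    rw [Real.norm_of_nonneg (hg0 p), hg]
    by_cases hp : p ∈ S K
    · rw [Set.indicator_of_mem hp]
      exact pow_le_pow_left₀ (norm_nonneg _) hp 2
    · rw [Set.indicator_of_notMem hp]; positivity
  have hpos : 0 < ∫ p, g p ∂ρ := by
    rw [integral_pos_iff_support_of_nonneg hg0 hgi]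
    refine (pos_iff_ne_zero.2 hK).trans_le (measure_mono fun p hp => ?_)
    rw [Function.mem_support, hg, Set.indicator_of_mem hp.2]
    exact pow_ne_zero 2 (norm_ne_zero_iff.2 (sub_ne_zero.2 hp.1))
  -- `2/π²` comes from `cos y ≤ 1 - (2/π²) y²` for `|y| ≤ π`; the radius `1/(K+1)` keeps the
  -- arguments in this range on `S K`.
  refine ⟨2 / Real.pi ^ 2 * ∫ p, g p ∂ρ, by positivity, 1 / ((K : ℝ) + 1), by positivity,
    fun v hv => ?_⟩
  have hci : ∀ w : ℂ, Integrable (fun p : ℂ × ℂ => Real.cos (inner ℝ (p.1 - p.2) w)) ρ := fun w =>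
    Integrable.of_bound (by fun_prop) 1 (.of_forall fun p => Real.abs_cos_le_one _)
  have hc1 : ∀ w : ℂ, 1 - ‖charFun ν w‖ ^ 2
      = ∫ p, (1 - Real.cos (inner ℝ (p.1 - p.2) w)) ∂ρ := fun w => by
    rw [integral_sub (integrable_const _) (hci w), sq_norm_charFun_eq_integral_cos,
      integral_const, probReal_univ, one_smul]
  have hci' : ∀ w : ℂ, Integrable (fun p : ℂ × ℂ => 1 - Real.cos (inner ℝ (p.1 - p.2) w)) ρ :=
    fun w => (integrable_const _).sub (hci w)
  rw [hc1, hc1, ← integral_add (hci' _) (hci' _),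
    mul_right_comm, ← integral_const_mul]
  refine integral_mono (hgi.const_mul _)
    ((hci' _).add (hci' _)) fun p => ?_
  dsimp only
  by_cases hp : p ∈ S K
  · rw [hg, Set.indicator_of_mem hp]
    set x := p.1 - p.2
    have hx : ‖x‖ ≤ K := hp
    have hxv : ‖x‖ * ‖v‖ ≤ Real.pi := by
      calc ‖x‖ * ‖v‖ ≤ K * (1 / ((K : ℝ) + 1)) := by gcongr
        _ ≤ 1 := by rw [mul_one_div, div_le_one (by positivity)]; linarith
        _ ≤ Real.pi := by linarith [Real.pi_gt_three]
    have b1 := Real.cos_le_one_sub_mul_cos_sq ((abs_real_inner_le_norm x v).trans hxv)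
    have b2 := Real.cos_le_one_sub_mul_cos_sq (x := inner ℝ x (v * I))
      ((abs_real_inner_le_norm x _).trans (by rwa [norm_mul, norm_I, mul_one]))
    -- Pythagoras: `v` and `v * I` are orthogonal of equal length.
    have e : inner ℝ x v ^ 2 + inner ℝ x (v * I) ^ 2 = ‖x‖ ^ 2 * ‖v‖ ^ 2 := by
      simp only [Complex.inner, ← normSq_eq_norm_sq, normSq_apply, mul_re, mul_im, conj_re, conj_im,
        I_re, I_im]
      ring
    have : 2 / Real.pi ^ 2 * ‖v‖ ^ 2 * ‖x‖ ^ 2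
        = 2 / Real.pi ^ 2 * inner ℝ x v ^ 2 + 2 / Real.pi ^ 2 * inner ℝ x (v * I) ^ 2 := by
      rw [← mul_add, e]; ring
    linarith
  · rw [hg, Set.indicator_of_notMem hp, mul_zero]
    linarith [Real.cos_le_one (inner ℝ (p.1 - p.2) v), Real.cos_le_one (inner ℝ (p.1 - p.2) (v * I))]

/-- From `a ≤ exp (-(1 - a))` the sum `t` satisfies `exp t ≤ 2`, and `t + 1 ≤ exp t`. -/
theorem sum_one_sub_le_one {ι : Type*} (s : Finset ι) (a : ι → ℝ) (h0 : ∀ i ∈ s, 0 ≤ a i)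
    (h : 1 / 2 ≤ ∏ i ∈ s, a i) : ∑ i ∈ s, (1 - a i) ≤ 1 := by
  set t := ∑ i ∈ s, (1 - a i) with ht
  have h1 : ∏ i ∈ s, a i ≤ Real.exp (-t) := by
    rw [ht, ← Finset.sum_neg_distrib, Real.exp_sum]
    refine Finset.prod_le_prod h0 fun i _ => ?_
    linarith [Real.add_one_le_exp (-(1 - a i))]
  have h2 := Real.add_one_le_exp t
  have h3 : Real.exp (-t) * Real.exp t = 1 := by rw [← Real.exp_add]; simp
  nlinarith [Real.exp_pos t]

/-- If linear combinations of independent copies of a nondegenerate law have characteristic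
functions bounded below by a fixed characteristic function, then their coefficients are uniformly
square summable. -/
theorem exists_sum_sq_le_of_norm_charFun_le {ι : Type*} (ν : Measure ℂ) [IsProbabilityMeasure ν]
    (hν : ¬ ∃ c : ℂ, ∀ᵐ x ∂ν, x = c) (χ : ℂ → ℂ) (hχ : Continuous χ) (hχ0 : χ 0 = 1) :
    ∃ M : ℝ, ∀ (s : Finset ι) (w : ι → ℂ),
      (∀ u, ‖χ u‖ ≤ ∏ i ∈ s, ‖charFun ν (conj (w i) * u)‖) → ∑ i ∈ s, ‖w i‖ ^ 2 ≤ M := by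
  obtain ⟨c, hc, δ, hδ, hcδ⟩ := exists_quadratic_bound_charFun ν hν
  -- `1/2` serves `sum_one_sub_le_one`; `c δ²/4` makes two defects of size `ε` smaller than `c δ²`
  -- in `hsmall`.
  set ε := min (1 / 2) (c * δ ^ 2 / 4)
  have hε : 0 < ε := by positivity
  obtain ⟨η, hη, hηχ⟩ : ∃ η > 0, ∀ u : ℂ, ‖u‖ ≤ η → 1 - ε ≤ ‖χ u‖ ^ 2 := by
    have h1 : ContinuousAt (fun u => ‖χ u‖ ^ 2) 0 := by fun_prop
    have h2 : ∀ᶠ u in nhds (0 : ℂ), 1 - ε < ‖χ u‖ ^ 2 :=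
      h1.eventually_const_lt (by simp [hχ0, hε])
    obtain ⟨η, hη, h⟩ := Metric.nhds_basis_closedBall.eventually_iff.1 h2
    exact ⟨η, hη, fun u hu => (h (by simpa using hu)).le⟩
  refine ⟨2 / (c * η ^ 2), fun s w h => ?_⟩
  set a : ℂ → ι → ℝ := fun u i => ‖charFun ν (conj (w i) * u)‖ ^ 2 with ha
  have ha0 : ∀ u i, 0 ≤ a u i := fun u i => sq_nonneg _
  have ha1 : ∀ u i, a u i ≤ 1 := fun u i => pow_le_one₀ (norm_nonneg _) (norm_charFun_le_one _)
  have hprod : ∀ u : ℂ, ‖u‖ ≤ η → 1 - ε ≤ ∏ i ∈ s, a u i := fun u hu => by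
    refine (hηχ u hu).trans ?_
    rw [ha, Finset.prod_pow]
    exact pow_le_pow_left₀ (norm_nonneg _) (h u) 2
  have hsingle : ∀ u : ℂ, ‖u‖ ≤ η → ∀ i ∈ s, 1 - a u i ≤ ε := fun u hu i hi => by
    have h1 : ∏ j ∈ s, a u j ≤ a u i := by
      classical
      rw [← Finset.mul_prod_erase s _ hi]
      exact mul_le_of_le_one_right (ha0 u i) (Finset.prod_le_one (fun j _ => ha0 u j) fun j _ => ha1 u j)
    linarith [hprod u hu]
  have hlow : ∀ (u : ℂ) (i : ι), ‖w i‖ * ‖u‖ ≤ δ →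
      c * (‖w i‖ * ‖u‖) ^ 2 ≤ (1 - a u i) + (1 - a (u * I) i) := fun u i hu => by
    have h1 : ‖conj (w i) * u‖ = ‖w i‖ * ‖u‖ := by rw [norm_mul, norm_conj]
    have := hcδ (conj (w i) * u) (h1.trans_le hu)
    rwa [h1, mul_assoc (conj (w i)) u I] at this
  -- A larger weight could be tested at some `‖u‖ ≤ η` with `‖w i‖ * ‖u‖ = δ`, giving `c δ² ≤ 2ε`.
  have hsmall : ∀ i ∈ s, ‖w i‖ * η ≤ δ := fun i hi => by
    by_contra! hcon
    have hw : 0 < ‖w i‖ := pos_of_mul_pos_left (hδ.trans hcon) hη.le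
    have hu : ‖((δ / ‖w i‖ : ℝ) : ℂ)‖ = δ / ‖w i‖ := by
      rw [norm_real, Real.norm_of_nonneg (by positivity)]
    have hle : δ / ‖w i‖ ≤ η := by rw [div_le_iff₀ hw]; linarith
    have e : ‖w i‖ * ‖((δ / ‖w i‖ : ℝ) : ℂ)‖ = δ := by rw [hu]; field_simp
    have h1 := hlow _ i e.le
    rw [e] at h1
    have h2 := hsingle ((δ / ‖w i‖ : ℝ) : ℂ) (hu.trans_le hle) i hi
    have h3 := hsingle (((δ / ‖w i‖ : ℝ) : ℂ) * I)
      (by rw [norm_mul, norm_I, mul_one]; exact hu.trans_le hle) i hi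
    have h4 : ε ≤ c * δ ^ 2 / 4 := min_le_right _ _
    have h5 : 0 < c * δ ^ 2 := by positivity
    linarith
  have hηn : ‖(η : ℂ)‖ = η := by rw [norm_real, Real.norm_of_nonneg hη.le]
  have hhalf : 1 / 2 ≤ 1 - ε := by linarith [min_le_left (1 / 2) (c * δ ^ 2 / 4)]
  have s1 := sum_one_sub_le_one s (a η) (fun i _ => ha0 _ i) (hhalf.trans (hprod _ hηn.le))
  have s2 := sum_one_sub_le_one s (a (η * I)) (fun i _ => ha0 _ i)
    (hhalf.trans (hprod _ (by rw [norm_mul, norm_I, mul_one]; exact hηn.le)))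
  rw [le_div_iff₀ (by positivity), Finset.sum_mul]
  calc ∑ i ∈ s, ‖w i‖ ^ 2 * (c * η ^ 2)
      ≤ ∑ i ∈ s, ((1 - a η i) + (1 - a (η * I) i)) := by
        refine Finset.sum_le_sum fun i hi => ?_
        have := hlow η i (by rw [hηn]; exact hsmall i hi)
        rw [hηn] at this
        linarith
    _ ≤ 2 := by rw [Finset.sum_add_distrib]; linarith

/-- The characteristic function of a linear combination of independent variables plus an
independent remainder is dominated by that of the linear combination. -/
theorem norm_charFun_le_prod {Ω ι κ : Type*} [MeasurableSpace Ω] {μ : Measure Ω}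
    [IsProbabilityMeasure μ] {X : ι → Ω → ℂ} (hXm : ∀ i, Measurable (X i)) (hX : iIndepFun X μ)
    {e : κ → ι} (he : Function.Injective e) (s : Finset κ) (w : κ → ℂ) {G : Set ι}
    (hG : ∀ k ∈ s, e k ∉ G) {V Y : Ω → ℂ}
    (hV : Measurable[⨆ i ∈ G, MeasurableSpace.comap (X i) inferInstance] V)
    (hY : Y =ᵐ[μ] fun ω => ∑ k ∈ s, w k * X (e k) ω + V ω) (u : ℂ) :
    ‖charFun (μ.map Y) u‖ ≤ ∏ k ∈ s, ‖charFun (μ.map (X (e k))) (conj (w k) * u)‖ := by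
  set m : ι → MeasurableSpace Ω := fun i => MeasurableSpace.comap (X i) inferInstance with hm
  have hle : ∀ i, m i ≤ ‹MeasurableSpace Ω› := fun i => (hXm i).comap_le
  have hVm : Measurable V := hV.mono (iSup₂_le fun i _ => hle i) le_rfl
  have hind : Indep (⨆ i ∈ e '' s, m i) (⨆ i ∈ G, m i) μ :=
    indep_iSup_of_disjoint hle ((iIndepFun_iff_iIndep _ _ _).1 hX) (by
      rw [Set.disjoint_left]
      rintro _ ⟨k, hk, rfl⟩
      exact hG k hk)
  have hUm : Measurable[⨆ i ∈ e '' s, m i] fun ω => ∑ k ∈ s, w k * X (e k) ω := by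
    refine Finset.measurable_sum _ fun k hk => Measurable.const_mul ?_ _
    exact Measurable.mono (comap_measurable _)
      (le_iSup₂_of_le (f := fun i (_ : i ∈ e '' s) => m i) (e k) (Set.mem_image_of_mem e hk) le_rfl)
      le_rfl
  have hUV : IndepFun (fun ω => ∑ k ∈ s, w k * X (e k) ω) V μ := by
    rw [IndepFun_iff_Indep]
    exact indep_of_indep_of_le_left (indep_of_indep_of_le_right hind hV.comap_le) hUm.comap_le
  have hU : iIndepFun (s.restrict fun k ω => w k * X (e k) ω) μ :=
    iIndepFun.restrict ((hX.precomp he).comp (fun k x => w k * x) fun k => by fun_prop) s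
  have hwm : ∀ k, Measurable fun ω => w k * X (e k) ω := fun k => (hXm _).const_mul _
  rw [Measure.map_congr hY, hUV.charFun_map_fun_add_eq_mul
      (Finset.measurable_sum _ fun k _ => hwm k).aemeasurable hVm.aemeasurable,
    hU.charFun_map_fun_finsetSum_eq_prod fun k _ => (hwm k).aemeasurable, Pi.mul_apply, norm_mul,
    Finset.prod_apply, norm_prod]
  have : IsProbabilityMeasure (μ.map V) := Measure.isProbabilityMeasure_map hVm.aemeasurable
  refine (mul_le_of_le_one_right (by positivity) (norm_charFun_le_one _)).trans_eq ?_
  exact Finset.prod_congr rfl fun k _ => by rw [charFun_map_const_mul (hXm _)]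

end

/-! ### Polynomials in the backward shifts -/

open MvPolynomial

/-- The backward shifts of a random field, as an action of the monoid of lags. -/
noncomputable def backshiftHom (d : ℕ) (Ω : Type*) :
    Multiplicative (Fin d →₀ ℕ) →* Module.End ℂ ((Fin d → ℤ) → Ω → ℂ) where
  toFun n :=
    { toFun := fun Y t => Y (t - lag n.toAdd)
      map_add' := fun _ _ => rfl
      map_smul' := fun _ _ => rfl }
  map_one' := by
    refine LinearMap.ext fun Y => funext fun t => congrArg Y ?_
    ext i; simp [lag]
  map_mul' m n := by
    refine LinearMap.ext fun Y => funext fun t => congrArg Y ?_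
    ext i; simp [lag]; ring

/-- A polynomial in the backward shifts, acting on random fields. -/
noncomputable def backshift (d : ℕ) (Ω : Type*) :
    MvPolynomial (Fin d) ℂ →ₐ[ℂ] Module.End ℂ ((Fin d → ℤ) → Ω → ℂ) :=
  AddMonoidAlgebra.lift ℂ (Module.End ℂ ((Fin d → ℤ) → Ω → ℂ)) (Fin d →₀ ℕ) (backshiftHom d Ω)

theorem backshift_apply {d : ℕ} {Ω : Type*} (P : MvPolynomial (Fin d) ℂ)
    (Y : (Fin d → ℤ) → Ω → ℂ) (t : Fin d → ℤ) (ω : Ω) :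
    backshift d Ω P Y t ω = ∑ n ∈ P.support, P.coeff n * Y (t - lag n) ω := by
  rw [backshift, AddMonoidAlgebra.lift_apply, MvPolynomial.sum_def]
  simp [LinearMap.sum_apply, Finset.sum_apply, backshiftHom]

theorem backshift_monomial_apply {d : ℕ} {Ω : Type*} (n : Fin d →₀ ℕ) (a : ℂ)
    (Y : (Fin d → ℤ) → Ω → ℂ) (t : Fin d → ℤ) (ω : Ω) :
    backshift d Ω (monomial n a) Y t ω = a * Y (t - lag n) ω := by
  rw [backshift, ← single_eq_monomial, AddMonoidAlgebra.lift_single]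
  simp [backshiftHom]

/-- The polynomial with coefficients `a` on the finite set `S` of exponents. -/
noncomputable def lagPoly {d : ℕ} (S : Finset (Fin d → ℕ)) (a : (Fin d → ℕ) → ℂ) :
    MvPolynomial (Fin d) ℂ :=
  ∑ n ∈ S, monomial (Finsupp.equivFunOnFinite.symm n) (a n)

theorem eval_lagPoly {d : ℕ} (S : Finset (Fin d → ℕ)) (a : (Fin d → ℕ) → ℂ) (z : Fin d → ℂ) :
    eval z (lagPoly S a) = ∑ n ∈ S, a n * ∏ i, z i ^ n i := by
  simp [lagPoly, eval_monomial, Finsupp.prod_fintype]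

open Classical in
theorem coeff_lagPoly {d : ℕ} (S : Finset (Fin d → ℕ)) (a : (Fin d → ℕ) → ℂ) (n : Fin d →₀ ℕ) :
    (lagPoly S a).coeff n = if ⇑n ∈ S then a n else 0 := by
  have : ∀ m : Fin d → ℕ, Finsupp.equivFunOnFinite.symm m = n ↔ m = n := fun m => by
    rw [Equiv.symm_apply_eq]; rfl
  simp [lagPoly, coeff_sum, coeff_monomial, this]

theorem backshift_lagPoly_apply {d : ℕ} {Ω : Type*} (S : Finset (Fin d → ℕ))
    (a : (Fin d → ℕ) → ℂ) (Y : (Fin d → ℤ) → Ω → ℂ) (t : Fin d → ℤ) (ω : Ω) :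
    backshift d Ω (lagPoly S a) Y t ω = ∑ n ∈ S, a n * Y (t - lag n) ω := by
  simp [lagPoly, map_sum, LinearMap.sum_apply, Finset.sum_apply, backshift_monomial_apply]

theorem coeff_eq_zero_of_maPoly_eq_one {d : ℕ} {S : Finset (Fin d → ℕ)} {θ : (Fin d → ℕ) → ℂ}
    (h : ∀ z, maPoly S θ z = 1) {n : Fin d → ℕ} (hn : n ∈ S) : θ n = 0 := by
  have h0 : lagPoly S θ = 0 := MvPolynomial.funext fun z => by
    have := h z
    rw [maPoly, add_eq_left] at this
    rw [eval_lagPoly, this, map_zero]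
  have := coeff_lagPoly S θ (Finsupp.equivFunOnFinite.symm n)
  rw [h0] at this
  simpa [hn] using this.symm

/-- `A` lies in the ideal generated by the variables, so `A ^ N` lies in its `N`-th power. -/
theorem le_degree_of_mem_support_pow {σ : Type*} {A : MvPolynomial σ ℂ} (hA : A.coeff 0 = 0)
    (N : ℕ) {n : σ →₀ ℕ} (hn : n ∈ (A ^ N).support) : N ≤ n.degree := by
  refine (mem_pow_idealOfVars_iff N _).1 (Ideal.pow_mem_pow ?_ N) n hn
  rw [← pow_one (idealOfVars σ ℂ), mem_pow_idealOfVars_iff']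
  intro x hx
  rw [(Finsupp.degree_eq_zero_iff x).1 (by omega), hA]

/-! ### Iterating the equation and using causality -/

variable {Ω : Type*} [MeasurableSpace Ω]

/-- A solution of the autoregressive equation, iterated `N` times. -/
theorem ae_eq_backshift_geom_sum_add {d : ℕ} {μ : Measure Ω} {Z Y : (Fin d → ℤ) → Ω → ℂ}
    (A : MvPolynomial (Fin d) ℂ) (h : ∀ t, ∀ᵐ ω ∂μ, Y t ω - backshift d Ω A Y t ω = Z t ω)
    (N : ℕ) (t : Fin d → ℤ) :
    ∀ᵐ ω ∂μ, Y t ω = backshift d Ω (∑ j ∈ Finset.range N, A ^ j) Z t ω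
      + backshift d Ω (A ^ N) Y t ω := by
  -- The index set is countable, so one null set serves all `t` and the geometric sum identity
  -- applies pathwise.
  filter_upwards [ae_all_iff.2 h] with ω hω
  have h1 := congrArg (fun P => backshift d Ω P Y t ω) (geom_sum_mul_neg A N)
  have h2 : ∀ P, backshift d Ω (1 - P) Y = Y - backshift d Ω P Y := fun P => by
    rw [map_sub, map_one]; rfl
  simp only [map_mul, Module.End.mul_apply, h2] at h1
  rw [backshift_apply] at h1
  simp only [Pi.sub_apply, hω] at h1
  rw [← backshift_apply] at h1
  linear_combination -h1

theorem sum_coord_sub_lag {d : ℕ} (n : Fin d →₀ ℕ) : ∑ i, (0 - lag n : Fin d → ℤ) i = -n.degree := by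
  simp [lag, Finsupp.degree_eq_sum]

/-- The law of a causal solution at the origin has a characteristic function dominated by that of
the low order part of its iterated expansion. -/
theorem norm_charFun_le_prod_of_causal {d : ℕ} {μ : Measure Ω} [IsProbabilityMeasure μ]
    {Z Y : (Fin d → ℤ) → Ω → ℂ} (hZ : IsIIDField μ Z) (A : MvPolynomial (Fin d) ℂ)
    (hA : A.coeff 0 = 0) (h : ∀ t, ∀ᵐ ω ∂μ, Y t ω - backshift d Ω A Y t ω = Z t ω)
    (hY : ∀ t, Measurable[pastSigma Z t] (Y t)) (N : ℕ) (u : ℂ) :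
    ‖charFun (μ.map (Y 0)) u‖ ≤
      ∏ n ∈ (∑ j ∈ Finset.range N, A ^ j).support with n.degree < N,
        ‖charFun (μ.map (Z 0)) ((starRingEnd ℂ) ((∑ j ∈ Finset.range N, A ^ j).coeff n) * u)‖ := by
  set T := ∑ j ∈ Finset.range N, A ^ j with hT
  -- This half-space contains the past of each of its points, and omits `-n` when `n` has degree
  -- below `N`.
  set G : Set (Fin d → ℤ) := {t | ∑ i, t i ≤ -N} with hG
  set m : (Fin d → ℤ) → MeasurableSpace Ω := fun s => MeasurableSpace.comap (Z s) inferInstance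
  have hmem : ∀ n : Fin d →₀ ℕ, (0 - lag n : Fin d → ℤ) ∈ G ↔ N ≤ n.degree := fun n => by
    rw [hG, Set.mem_ofPred_eq, sum_coord_sub_lag]; omega
  have hZG : ∀ n : Fin d →₀ ℕ, N ≤ n.degree → Measurable[⨆ s ∈ G, m s] (Z (0 - lag n)) := fun n hn =>
    Measurable.mono (comap_measurable _)
      (le_iSup₂_of_le (f := fun s (_ : s ∈ G) => m s) _ ((hmem n).2 hn) le_rfl) le_rfl
  have hYG : ∀ n : Fin d →₀ ℕ, N ≤ n.degree → Measurable[⨆ s ∈ G, m s] (Y (0 - lag n)) := fun n hn =>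
    (hY _).mono (iSup₂_le fun s hs => le_iSup₂_of_le (f := fun s (_ : s ∈ G) => m s) s
      ((Finset.sum_le_sum fun i _ => hs i).trans ((hmem n).2 hn)) le_rfl) le_rfl
  have hinj : Function.Injective fun n : Fin d →₀ ℕ => (0 - lag n : Fin d → ℤ) := fun n n' hn => by
    ext i
    simpa [lag] using congrFun hn i
  set V : Ω → ℂ := fun ω => ∑ n ∈ T.support with ¬ n.degree < N, T.coeff n * Z (0 - lag n) ω
    + ∑ n ∈ (A ^ N).support, (A ^ N).coeff n * Y (0 - lag n) ω with hV
  have hVm : Measurable[⨆ s ∈ G, m s] V := by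
    refine Measurable.add ?_ ?_
    · refine Finset.measurable_sum _ fun n hn => (hZG n ?_).const_mul _
      exact not_lt.1 (Finset.mem_filter.1 hn).2
    · exact Finset.measurable_sum _ fun n hn =>
        (hYG n (le_degree_of_mem_support_pow hA N hn)).const_mul _
  have hdec : Y 0 =ᵐ[μ] fun ω => ∑ n ∈ T.support with n.degree < N, T.coeff n * Z (0 - lag n) ω
      + V ω := by
    filter_upwards [ae_eq_backshift_geom_sum_add A h N 0] with ω hω
    rw [hω, backshift_apply, backshift_apply, hV, ← hT, ← add_assoc,
      Finset.sum_filter_add_sum_filter_not]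
  refine (norm_charFun_le_prod hZ.measurable hZ.indep hinj _ (fun n => T.coeff n)
    (fun n hn => ?_) hVm hdec u).trans_eq ?_
  · rw [hmem]
    exact not_le.2 (Finset.mem_filter.1 hn).2
  · exact Finset.prod_congr rfl fun n _ => by rw [(hZ.identDistrib (0 - lag n) 0).map_eq]

end SpatialARMA

theorem mainTheorem8 {Ω : Type*} [MeasurableSpace Ω] (μ : Measure Ω) [IsProbabilityMeasure μ]
    (Z : (Fin 2 → ℤ) → Ω → ℂ)
    (hZ : SpatialARMA.IsIIDField μ Z) (hZnd : SpatialARMA.IsNondeterministic μ Z)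
    (R S : Finset (Fin 2 → ℕ)) (hR : 0 ∉ R) (hS : 0 ∉ S)
    (φ θ : (Fin 2 → ℕ) → ℂ)
    (hΘ : ∀ z : Fin 2 → ℂ, SpatialARMA.maPoly S θ z = 1)
    (hsol : ∃ Y : (Fin 2 → ℤ) → Ω → ℂ, SpatialARMA.IsCausalSolution μ R S φ θ Z Y) :
    ∀ z : Fin 2 → ℂ, (∀ i, ‖z i‖ ≤ 1) → SpatialARMA.arPoly R φ z ≠ 0 := by
  open SpatialARMA in
  intro z hz
  obtain ⟨Y, hY⟩ := hsol
  have hA : (lagPoly R φ).coeff 0 = 0 := by rw [coeff_lagPoly]; simp [hR]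
  have hZ0 := hZ.measurable 0
  have hY0 : AEMeasurable (Y 0) μ :=
    ((hY.causal 0).mono (iSup₂_le fun s _ => (hZ.measurable s).comap_le) le_rfl).aemeasurable
  have : IsProbabilityMeasure (μ.map (Z 0)) := Measure.isProbabilityMeasure_map hZ0.aemeasurable
  have : IsProbabilityMeasure (μ.map (Y 0)) := Measure.isProbabilityMeasure_map hY0
  have hnd : ¬ ∃ c : ℂ, ∀ᵐ x ∂μ.map (Z 0), x = c := fun ⟨c, hc⟩ =>
    hZnd 0 ⟨c, ae_of_ae_map hZ0.aemeasurable hc⟩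
  have hAR : ∀ t, ∀ᵐ ω ∂μ, Y t ω - backshift 2 Ω (lagPoly R φ) Y t ω = Z t ω := fun t => by
    filter_upwards [hY.solves t] with ω hω
    rw [backshift_lagPoly_apply, hω, Finset.sum_eq_zero, add_zero]
    intro n hn
    rw [coeff_eq_zero_of_maPoly_eq_one hΘ hn, zero_mul]
  obtain ⟨M, hM⟩ := exists_sum_sq_le_of_norm_charFun_le (ι := Fin 2 →₀ ℕ) (μ.map (Z 0)) hnd
    (charFun (μ.map (Y 0))) continuous_charFun (by simp)
  rw [arPoly, ← eval_lagPoly]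
  exact one_sub_eval_ne_zero_of_sum_sq_le _ hA (fun N => hM _ _ fun u =>
    norm_charFun_le_prod_of_causal hZ _ hA hAR hY.causal N u) z hz
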